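/- Let $F$ be the distribution function of a probability law on $\mathbb{R}$ supported on $[1,\infty)$, and write $\overline F = 1-F$ and $F^{\leftarrow}(s)=\inf\{x\in(0,\infty): F(x)\ge s\}$. Assume that $F$ is continuous and that $F^{\leftarrow}$ is continuous on $(0,1)$. Let $X_1,X_2,\dots$ be i.i.d. random variables with distribution function $F$, and let $X_{1:n}\le\dots\le X_{n:n}$ be the order statistics of $X_1,\dots,X_n$. For $1\le k\le n-1$ define $$\widehat\alpha_{n,k}=\Big(\frac1k\sum_{i=1}^k\log\frac{X_{n-k+i:n}}{X_{n-k:n}}\Big)^{-1},\qquad D_{n,k}=\sup_{y\ge1}\Big|\frac1k\sum_{i=1}^k \mathbf 1_{(y,\infty)}\Big(\frac{X_{n-k+i:n}}{X_{n-k:n}}\Big)-y^{-\widehat\alpha_{n,k}}\Big|,$$ and let $\kappa_n^\star$ be the smallest minimiser of $k\mapsto D_{n,k}$ over $1\le k\le n-1$. Suppose that $F$ is eventually Pareto with exponent $\alpha>0$: there are $x>0$ and $c>0$ with $\overline F(y)=c\,y^{-\alpha}$ for all $y\ge x$. Let $x_0$ be the smallest such $x$, that is, the smallest $x>0$ such that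 $L(y)=y^{\alpha}\,\overline F(y)$ is constant on $[x,\infty)$. Then, for every $\varepsilon>0$, $$\lim_{n\to\infty}\mathbb P\big(\kappa_n^\star\ge n\,\overline F(x_0-\varepsilon)\big)=0 .$$ -/

import Mathlib

open MeasureTheory ProbabilityTheory Set Filter Topology

namespace PLFit

noncomputable section

/-- The tail function `F̄ = 1 - F` of a distribution function `F`. -/
def tail (F : ℝ → ℝ) (x : ℝ) : ℝ := 1 - F x

/-- The generalized inverse `F^←(s) = inf {x ∈ (0, ∞) : F(x) ≥ s}`. It is used for `0 < s < 1`. -/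
def quantile (F : ℝ → ℝ) (s : ℝ) : ℝ := sInf {x : ℝ | 0 < x ∧ s ≤ F x}

/-- `F` is Pareto with exponent `α` from the positive point `x` onwards: for some `c > 0`,
`F̄(y) = c y^{-α}` for all `y ≥ x`. -/
def ParetoFrom (F : ℝ → ℝ) (α x : ℝ) : Prop :=
  0 < x ∧ ∃ c : ℝ, 0 < c ∧ ∀ y : ℝ, x ≤ y → tail F y = c * y ^ (-α)

/-- The order statistic `X_{j:n}` (the `j`-th smallest observation, `1 ≤ j ≤ n`) of the sample
`x = (x_1, …, x_n)`. The value `0` for other `j` is never used. -/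
def orderStat {n : ℕ} (x : Fin n → ℝ) (j : ℕ) : ℝ :=
  if h : 1 ≤ j ∧ j ≤ n then x (Tuple.sort x ⟨j - 1, by omega⟩) else 0

/-- The ratio `X_{n-k+i:n} / X_{n-k:n}`, for `1 ≤ i ≤ k ≤ n - 1`. -/
def excess {n : ℕ} (x : Fin n → ℝ) (k i : ℕ) : ℝ :=
  orderStat x (n - k + i) / orderStat x (n - k)

/-- `H_{n,k} = (1/k) ∑_{i=1}^k log (X_{n-k+i:n} / X_{n-k:n})`. -/
def hillMean {n : ℕ} (x : Fin n → ℝ) (k : ℕ) : ℝ :=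
  (1 / (k : ℝ)) * ∑ i ∈ Finset.Icc 1 k, Real.log (excess x k i)

/-- Hill's estimator `α̂_{n,k} = H_{n,k}⁻¹`. -/
def hillEstimator {n : ℕ} (x : Fin n → ℝ) (k : ℕ) : ℝ := (hillMean x k)⁻¹

/-- The Kolmogorov–Smirnov distance
`D_{n,k} = sup_{y ≥ 1} |(1/k) ∑_{i=1}^k 1_{(y,∞)}(X_{n-k+i:n} / X_{n-k:n}) - y^{-α̂_{n,k}}|`. -/
def ksDist {n : ℕ} (x : Fin n → ℝ) (k : ℕ) : ℝ :=
  ⨆ y : Set.Ici (1 : ℝ),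
    |(1 / (k : ℝ)) * ∑ i ∈ Finset.Icc 1 k,
        (Set.Ioi (y : ℝ)).indicator (fun _ => (1 : ℝ)) (excess x k i)
      - (y : ℝ) ^ (-hillEstimator x k)|

/-- `κ_n^⋆`: the smallest minimiser of `k ↦ D_{n,k}` over `1 ≤ k ≤ n - 1` (for `n ≥ 2`). -/
def kappaStar {n : ℕ} (x : Fin n → ℝ) : ℕ :=
  sInf {k : ℕ | k ∈ Finset.Icc 1 (n - 1) ∧ ∀ j ∈ Finset.Icc 1 (n - 1), ksDist x k ≤ ksDist x j}

end

end PLFit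

namespace PLFit

noncomputable section

/-! Write `T` for the tail of the law. Distances near zero occur only at fractions k/n whose
threshold lies in the Pareto range. By the law of large numbers the empirical tail converges to `T`.
If k/n tends to t > 0, the order statistic `X_{n-k:n}` therefore clusters at some q with `T q = t`.
A vanishing distance at such k forces `T (y * q) / T q` to be a pure power of y
(`exists_pareto_of_tendsto_ksDist_zero`). The power must be -α (`exponent_eq`), so q is a Pareto
point; minimality gives x₀ ≤ q and t ≤ `T x₀`. Conversely the distance does vanish at k = ⌊n T(2x₀)⌋
(`tendsto_ksDist_zero`), hence also at the minimiser. But `T x₀ < T (x₀ - ε)`, since continuity of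
the quantile function forbids flat stretches of F (`tail_cdf_lt_of_lt`).

Convergence in probability is encoded by `sampleFilter`. If the claim failed, some ultrafilter finer
than it would contain the bad event; along an ultrafilter every bounded quantity converges, so no
subsequences are needed. -/

/-- The empirical tail function of a sample. -/
def empTail {n : ℕ} (x : Fin n → ℝ) (b : ℝ) : ℝ :=
  (∑ i, (Ioi b).indicator (fun _ => (1 : ℝ)) (x i)) / n

/-- The sample mean of `log⁺ (x_i / q)`. -/
def empLogExcess {n : ℕ} (x : Fin n → ℝ) (q : ℝ) : ℝ :=
  (∑ i, max 0 (Real.log (x i / q))) / n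

/-! ### Order statistics as functionals of the whole sample. -/

lemma orderStat_of_mem {n : ℕ} (x : Fin n → ℝ) {j : ℕ} (h : 1 ≤ j ∧ j ≤ n) :
    orderStat x j = x (Tuple.sort x ⟨j - 1, by omega⟩) := dif_pos h

lemma orderStat_mono {n : ℕ} (x : Fin n → ℝ) {i j : ℕ} (hi : 1 ≤ i) (hij : i ≤ j) (hj : j ≤ n) :
    orderStat x i ≤ orderStat x j := by
  rw [orderStat_of_mem x ⟨hi, hij.trans hj⟩, orderStat_of_mem x ⟨hi.trans hij, hj⟩]
  refine Tuple.monotone_sort x (?_ : (⟨i - 1, _⟩ : Fin n) ≤ ⟨j - 1, _⟩)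
  rw [Fin.mk_le_mk]; omega

lemma one_le_orderStat {n : ℕ} {x : Fin n → ℝ} (hx : ∀ i, 1 ≤ x i) {j : ℕ} (hj : 1 ≤ j)
    (hjn : j ≤ n) : 1 ≤ orderStat x j := by
  rw [orderStat_of_mem x ⟨hj, hjn⟩]; exact hx _

lemma sum_orderStat {n : ℕ} (x : Fin n → ℝ) (g : ℝ → ℝ) :
    ∑ i ∈ Finset.range n, g (orderStat x (i + 1)) = ∑ i, g (x i) := by
  rw [← Equiv.sum_comp (Tuple.sort x) (fun i => g (x i)), Finset.sum_range]
  refine Finset.sum_congr rfl fun i _ => ?_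
  rw [orderStat_of_mem x ⟨by omega, by omega⟩]
  rfl

lemma sum_eq_bottom_add_top {n k : ℕ} (hk : k ≤ n) (x : Fin n → ℝ) (g : ℝ → ℝ) :
    ∑ i, g (x i) = ∑ i ∈ Finset.range (n - k), g (orderStat x (i + 1)) +
      ∑ i ∈ Finset.Icc 1 k, g (orderStat x (n - k + i)) := by
  rw [← sum_orderStat]
  obtain ⟨m, hm⟩ := Nat.exists_eq_add_of_le' hk
  have h1 : n - k = m := by omega
  rw [h1]
  rw [show Finset.range n = Finset.range (m + k) by rw [← hm], Finset.sum_range_add]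
  congr 1
  have : Finset.Icc 1 k = (Finset.range k).map (addRightEmbedding 1) := by
    ext i; simp only [Finset.mem_Icc, Finset.mem_map, Finset.mem_range, addRightEmbedding_apply]
    exact ⟨fun h => ⟨i - 1, by omega, by omega⟩, by rintro ⟨a, h, rfl⟩; omega⟩
  rw [this, Finset.sum_map]
  rfl

/-- The lower order statistics contribute nothing. This turns sums over the top k into full-sample
sums, to which the law of large numbers applies. -/
lemma sum_top_eq {n k : ℕ} (hk : k < n) (x : Fin n → ℝ) (g : ℝ → ℝ)
    (hg : ∀ z ≤ orderStat x (n - k), g z = 0) :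
    ∑ i ∈ Finset.Icc 1 k, g (orderStat x (n - k + i)) = ∑ i, g (x i) := by
  rw [sum_eq_bottom_add_top hk.le x g, right_eq_add]
  refine Finset.sum_eq_zero fun i hi => ?_
  rw [Finset.mem_range] at hi
  exact hg _ (orderStat_mono x (by omega) (by omega) (by omega))

lemma empTail_antitone {n : ℕ} (x : Fin n → ℝ) : Antitone (empTail x) := by
  intro a b hab
  unfold empTail
  gcongr

lemma empTail_orderStat_le {n k : ℕ} (hk : k < n) (x : Fin n → ℝ) :
    empTail x (orderStat x (n - k)) ≤ (k : ℝ) / n := by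
  unfold empTail
  rw [← sum_top_eq hk x ((Ioi (orderStat x (n - k))).indicator fun _ => (1 : ℝ))
    fun z hz => Set.indicator_of_notMem (by simpa using hz) _]
  gcongr
  refine (Finset.sum_le_sum (g := fun _ => (1 : ℝ)) fun i _ =>
    Set.indicator_le_self' (fun _ _ => zero_le_one) _).trans ?_
  simp

lemma le_empTail_of_lt_orderStat {n k : ℕ} (hk : k < n) (x : Fin n → ℝ) {b : ℝ}
    (hb : b < orderStat x (n - k)) : (k : ℝ) / n ≤ empTail x b := by
  unfold empTail
  rw [sum_eq_bottom_add_top hk.le x]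
  gcongr
  refine le_add_of_nonneg_of_le
    (Finset.sum_nonneg fun i _ => Set.indicator_nonneg (fun _ _ => zero_le_one) _) ?_
  have : ∀ i ∈ Finset.Icc 1 k,
      (Ioi b).indicator (fun _ => (1 : ℝ)) (orderStat x (n - k + i)) = 1 := by
    intro i hi
    rw [Finset.mem_Icc] at hi
    exact Set.indicator_of_mem
      (hb.trans_le (orderStat_mono x (by omega) (by omega) (by omega))) _
  rw [Finset.sum_congr rfl this]
  simp

lemma exceedance_eq_empTail {n k : ℕ} (hk : k < n) {x : Fin n → ℝ}
    (hx : ∀ i, 1 ≤ x i) {y : ℝ} (hy : 1 ≤ y) :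
    (1 / (k : ℝ)) * ∑ i ∈ Finset.Icc 1 k,
        (Set.Ioi y).indicator (fun _ => (1 : ℝ)) (excess x k i) =
      empTail x (y * orderStat x (n - k)) / ((k : ℝ) / n) := by
  have hq : 0 < orderStat x (n - k) :=
    zero_lt_one.trans_le (one_le_orderStat hx (by omega) (by omega))
  have hn : (n : ℝ) ≠ 0 := by norm_cast; omega
  have h := sum_top_eq hk x ((Ioi (y * orderStat x (n - k))).indicator fun _ => (1 : ℝ))
    fun z hz => Set.indicator_of_notMem (by
      simp only [mem_Ioi, not_lt]; nlinarith) _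
  have h2 : ∀ i, (Set.Ioi y).indicator (fun _ => (1 : ℝ)) (excess x k i) =
      (Ioi (y * orderStat x (n - k))).indicator (fun _ => (1 : ℝ)) (orderStat x (n - k + i)) := by
    intro i
    simp only [Set.indicator_apply, mem_Ioi, excess, lt_div_iff₀ hq]
  simp only [h2, h, empTail]
  field_simp

lemma hillMean_eq {n k : ℕ} (hk : k < n) {x : Fin n → ℝ} (hx : ∀ i, 1 ≤ x i) :
    hillMean x k = empLogExcess x (orderStat x (n - k)) / ((k : ℝ) / n) := by
  have hq : 0 < orderStat x (n - k) :=
    zero_lt_one.trans_le (one_le_orderStat hx (by omega) (by omega))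
  have hn : (n : ℝ) ≠ 0 := by norm_cast; omega
  have h : ∑ i ∈ Finset.Icc 1 k, Real.log (excess x k i) =
      ∑ i, max 0 (Real.log (x i / orderStat x (n - k))) := by
    rw [sum_eq_bottom_add_top hk.le x fun z => max 0 (Real.log (z / orderStat x (n - k))),
      ← zero_add (∑ i ∈ Finset.Icc 1 k, Real.log _)]
    congr 1
    rotate_left
    · refine Finset.sum_congr rfl fun i hi => ?_
      rw [Finset.mem_Icc] at hi
      refine (max_eq_right (Real.log_nonneg ?_)).symm
      rw [excess, one_le_div hq]
      exact orderStat_mono x (by omega) (by omega) (by omega)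
    · refine (Finset.sum_eq_zero fun i hi => ?_).symm
      rw [Finset.mem_range] at hi
      refine max_eq_left (Real.log_nonpos ?_ ?_)
      · exact div_nonneg
          (zero_le_one.trans (one_le_orderStat hx (by omega) (by omega))) hq.le
      · rw [div_le_one hq]
        exact orderStat_mono x (by omega) (by omega) (by omega)
  rw [hillMean, h, empLogExcess]
  field_simp

lemma empLogExcess_nonneg {n : ℕ} (x : Fin n → ℝ) (q : ℝ) : 0 ≤ empLogExcess x q :=
  div_nonneg (Finset.sum_nonneg fun _ _ => le_max_left _ _) (Nat.cast_nonneg _)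

lemma hillEstimator_nonneg {n k : ℕ} (hk : k < n) {x : Fin n → ℝ} (hx : ∀ i, 1 ≤ x i) :
    0 ≤ hillEstimator x k := by
  rw [hillEstimator, hillMean_eq hk hx]
  exact inv_nonneg.2 (div_nonneg (empLogExcess_nonneg _ _) (by positivity))

/-- The positive part is 1-Lipschitz. This lets a random threshold be replaced by its deterministic
limit. -/
lemma abs_empLogExcess_sub_le {n : ℕ} (hn : 0 < n) {x : Fin n → ℝ} (hx : ∀ i, 1 ≤ x i)
    {p q : ℝ} (hp : 0 < p) (hq : 0 < q) :
    |empLogExcess x p - empLogExcess x q| ≤ |Real.log p - Real.log q| := by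
  have hn' : (0 : ℝ) < n := by exact_mod_cast hn
  unfold empLogExcess
  rw [← sub_div, abs_div, abs_of_pos hn', div_le_iff₀ hn', ← Finset.sum_sub_distrib]
  refine (Finset.abs_sum_le_sum_abs _ _).trans ?_
  refine (Finset.sum_le_sum (g := fun _ => |Real.log p - Real.log q|) fun i _ => ?_).trans
    (by simp [mul_comm])
  have hxi : 0 < x i := zero_lt_one.trans_le (hx i)
  rw [Real.log_div hxi.ne' hp.ne', Real.log_div hxi.ne' hq.ne']
  refine (abs_max_sub_max_le_max _ _ _ _).trans ?_
  rw [sub_self, abs_zero, max_eq_right (abs_nonneg _), abs_sub_comm (Real.log p)]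
  refine le_of_eq (congrArg _ (by ring))

lemma exceedance_mem_Icc {n k : ℕ} (x : Fin n → ℝ) (y : ℝ) :
    (1 / (k : ℝ)) * ∑ i ∈ Finset.Icc 1 k,
        (Set.Ioi y).indicator (fun _ => (1 : ℝ)) (excess x k i) ∈ Icc (0 : ℝ) 1 := by
  constructor
  · exact mul_nonneg (by positivity)
      (Finset.sum_nonneg fun i _ => Set.indicator_nonneg (fun _ _ => zero_le_one) _)
  · rw [one_div, inv_mul_eq_div]
    refine div_le_one_of_le₀ ?_ (Nat.cast_nonneg _)
    refine (Finset.sum_le_sum (g := fun _ => (1 : ℝ)) fun i _ =>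
      Set.indicator_le_self' (fun _ _ => zero_le_one) _).trans ?_
    simp

lemma le_ksDist {n k : ℕ} (hk : k < n) {x : Fin n → ℝ} (hx : ∀ i, 1 ≤ x i) {y : ℝ}
    (hy : 1 ≤ y) :
    |empTail x (y * orderStat x (n - k)) / ((k : ℝ) / n) - y ^ (-hillEstimator x k)| ≤
      ksDist x k := by
  rw [← exceedance_eq_empTail hk hx hy]
  refine le_ciSup (f := fun y : Set.Ici (1 : ℝ) =>
    |(1 / (k : ℝ)) * ∑ i ∈ Finset.Icc 1 k,
        (Set.Ioi (y : ℝ)).indicator (fun _ => (1 : ℝ)) (excess x k i)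
      - (y : ℝ) ^ (-hillEstimator x k)|) ⟨1, ?_⟩ ⟨y, hy⟩
  rintro _ ⟨⟨z, hz⟩, rfl⟩
  have h1 := exceedance_mem_Icc (k := k) x z
  have h2 : z ^ (-hillEstimator x k) ≤ 1 :=
    Real.rpow_le_one_of_one_le_of_nonpos hz (neg_nonpos.2 (hillEstimator_nonneg hk hx))
  have h3 : 0 ≤ z ^ (-hillEstimator x k) :=
    Real.rpow_nonneg (zero_le_one.trans hz) _
  rw [abs_le]
  constructor <;> dsimp only <;> linarith [h1.1, h1.2]

lemma exists_lt_of_lt_ksDist {n k : ℕ} (hk : k < n) {x : Fin n → ℝ} (hx : ∀ i, 1 ≤ x i)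
    {δ : ℝ} (h : δ < ksDist x k) : ∃ y : ℝ, 1 ≤ y ∧
      δ < |empTail x (y * orderStat x (n - k)) / ((k : ℝ) / n) - y ^ (-hillEstimator x k)| := by
  have : Nonempty (Set.Ici (1 : ℝ)) := ⟨⟨1, mem_Ici.2 le_rfl⟩⟩
  obtain ⟨⟨y, hy⟩, h⟩ := exists_lt_of_lt_ciSup h
  refine ⟨y, hy, ?_⟩
  rwa [← exceedance_eq_empTail hk hx hy]

lemma ksDist_nonneg {n k : ℕ} (x : Fin n → ℝ) : 0 ≤ ksDist x k :=
  Real.iSup_nonneg fun _ => abs_nonneg _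

lemma kappaStar_spec {n : ℕ} (hn : 2 ≤ n) (x : Fin n → ℝ) :
    kappaStar x ∈ Finset.Icc 1 (n - 1) ∧
      ∀ j ∈ Finset.Icc 1 (n - 1), ksDist x (kappaStar x) ≤ ksDist x j := by
  obtain ⟨k, hk, h⟩ := Finset.exists_min_image (Finset.Icc 1 (n - 1)) (ksDist x)
    ⟨1, Finset.mem_Icc.2 ⟨le_rfl, by omega⟩⟩
  exact Nat.sInf_mem (s := {k : ℕ | k ∈ Finset.Icc 1 (n - 1) ∧
    ∀ j ∈ Finset.Icc 1 (n - 1), ksDist x k ≤ ksDist x j}) ⟨k, hk, h⟩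

end

/-! ### Deterministic limits along an ultrafilter of samples. -/

/-- Finite real samples of arbitrary size. -/
abbrev Sample := Σ n : ℕ, Fin n → ℝ

lemma exists_tendsto_of_eventually_mem_Icc {ι : Type*} {U : Ultrafilter ι} {f : ι → ℝ} {a b : ℝ}
    (h : ∀ᶠ i in (U : Filter ι), f i ∈ Icc a b) :
    ∃ x ∈ Icc a b, Tendsto f U (𝓝 x) :=
  isCompact_Icc.ultrafilter_le_nhds (U.map f) (le_principal_iff.2 h)

/-- Monotonicity squeezes the value at a moving point between values at fixed points on either side
of its limit, so pointwise convergence suffices. -/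
lemma tendsto_empTail_comp {l : Filter Sample} {T : ℝ → ℝ} (hT : Continuous T)
    (h : ∀ b, Tendsto (fun p : Sample => empTail p.2 b) l (𝓝 (T b))) {z : Sample → ℝ} {z₀ : ℝ}
    (hz : Tendsto z l (𝓝 z₀)) : Tendsto (fun p => empTail p.2 (z p)) l (𝓝 (T z₀)) := by
  refine tendsto_order.2 ⟨fun a ha => ?_, fun a ha => ?_⟩
  · have h1 : ∀ᶠ b in 𝓝[>] z₀, a < T b :=
      (hT.tendsto z₀).mono_left nhdsWithin_le_nhds |>.eventually_const_lt ha
    obtain ⟨b, hb, hzb⟩ := (h1.and self_mem_nhdsWithin).exists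
    filter_upwards [(h b).eventually_const_lt hb, hz.eventually_lt_const hzb] with p h2 h3
    exact h2.trans_le (empTail_antitone _ h3.le)
  · have h1 : ∀ᶠ b in 𝓝[<] z₀, T b < a :=
      (hT.tendsto z₀).mono_left nhdsWithin_le_nhds |>.eventually_lt_const ha
    obtain ⟨b, hb, hzb⟩ := (h1.and self_mem_nhdsWithin).exists
    filter_upwards [(h b).eventually_lt_const hb, hz.eventually_const_lt hzb] with p h2 h3
    exact (empTail_antitone _ h3.le).trans_lt h2

lemma tendsto_empTail_comp_atTop {l : Filter Sample} {T : ℝ → ℝ} (hT : Tendsto T atTop (𝓝 0))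
    (h : ∀ b, Tendsto (fun p : Sample => empTail p.2 b) l (𝓝 (T b))) {z : Sample → ℝ}
    (hz : Tendsto z l atTop) : Tendsto (fun p => empTail p.2 (z p)) l (𝓝 0) := by
  refine tendsto_order.2 ⟨fun a ha => Eventually.of_forall fun p => ha.trans_le ?_,
    fun a ha => ?_⟩
  · exact div_nonneg (Finset.sum_nonneg fun i _ => Set.indicator_nonneg
      (fun _ _ => zero_le_one) _) (Nat.cast_nonneg _)
  · obtain ⟨b, hb⟩ := (hT.eventually_lt_const ha).exists
    filter_upwards [(h b).eventually_lt_const hb, hz.eventually_ge_atTop b] with p h2 h3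
    exact (empTail_antitone _ h3).trans_lt h2

/-- A level B with `T B < t` eventually bounds the order statistic, so compactness yields a limit q.
Counting exceedances above and just below it pins `T q` from both sides. -/
lemma exists_tendsto_orderStat {U : Ultrafilter Sample} {T : ℝ → ℝ} (hT : Continuous T)
    (hT0 : Tendsto T atTop (𝓝 0))
    (h : ∀ b, Tendsto (fun p : Sample => empTail p.2 b) U (𝓝 (T b)))
    (h1 : ∀ᶠ p : Sample in U, ∀ i, 1 ≤ p.2 i) {k : Sample → ℕ}
    (hk : ∀ᶠ p : Sample in U, k p < p.1) {t : ℝ} (ht : 0 < t)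
    (hkt : Tendsto (fun p : Sample => (k p : ℝ) / p.1) U (𝓝 t)) :
    ∃ q, 1 ≤ q ∧ Tendsto (fun p : Sample => orderStat p.2 (p.1 - k p)) U (𝓝 q) ∧ T q = t := by
  obtain ⟨B, hB⟩ := (hT0.eventually_lt_const ht).exists
  have hmem : ∀ᶠ p : Sample in U, orderStat p.2 (p.1 - k p) ∈ Icc 1 B := by
    filter_upwards [h1, hk, (h B).eventually_lt hkt hB] with p hp1 hpk hpB
    refine ⟨one_le_orderStat hp1 (by omega) (by omega), ?_⟩
    by_contra! hlt
    exact (le_empTail_of_lt_orderStat hpk p.2 hlt).not_gt hpB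
  obtain ⟨q, hq, hlim⟩ := exists_tendsto_of_eventually_mem_Icc hmem
  refine ⟨q, hq.1, hlim, le_antisymm ?_ ?_⟩
  · refine le_of_tendsto_of_tendsto (tendsto_empTail_comp hT h hlim) hkt ?_
    filter_upwards [hk] with p hpk using empTail_orderStat_le hpk p.2
  · have hleft : Tendsto T (𝓝[<] q) (𝓝 (T q)) := (hT.tendsto q).mono_left nhdsWithin_le_nhds
    refine ge_of_tendsto hleft ?_
    filter_upwards [self_mem_nhdsWithin] with b hb
    refine le_of_tendsto_of_tendsto hkt (h b) ?_
    filter_upwards [hk, hlim.eventually_const_lt hb] with p hpk hpb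
      using le_empTail_of_lt_orderStat hpk p.2 hpb

lemma tendsto_hillEstimator {U : Ultrafilter Sample} {T : ℝ → ℝ}
    (h1 : ∀ᶠ p : Sample in U, ∀ i, 1 ≤ p.2 i) {k : Sample → ℕ}
    (hk : ∀ᶠ p : Sample in U, k p < p.1) {q α : ℝ} (hq : 0 < q) (hα : 0 < α) (hTq : 0 < T q)
    (hkt : Tendsto (fun p : Sample => (k p : ℝ) / p.1) U (𝓝 (T q)))
    (hlim : Tendsto (fun p : Sample => orderStat p.2 (p.1 - k p)) U (𝓝 q))
    (hlog : Tendsto (fun p : Sample => empLogExcess p.2 q) U (𝓝 (T q / α))) :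
    Tendsto (fun p : Sample => hillEstimator p.2 (k p)) U (𝓝 α) := by
  have hd : Tendsto (fun p : Sample => empLogExcess p.2 (orderStat p.2 (p.1 - k p)) -
      empLogExcess p.2 q) U (𝓝 0) := by
    have h2 : Tendsto (fun p : Sample =>
        |Real.log (orderStat p.2 (p.1 - k p)) - Real.log q|) U (𝓝 0) := by
      have := ((Real.continuousAt_log hq.ne').tendsto.comp hlim).sub_const (Real.log q)
      rw [sub_self] at this
      simpa using this.abs
    refine squeeze_zero_norm' ?_ h2
    filter_upwards [h1, hk] with p hp1 hpk
    exact abs_empLogExcess_sub_le (by omega) hp1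
      (zero_lt_one.trans_le (one_le_orderStat hp1 (by omega) (by omega))) hq
  have hE := hd.add hlog
  simp only [sub_add_cancel, zero_add] at hE
  have h3 := (hE.div hkt hTq.ne').inv₀ (by positivity)
  rw [show (T q / α / T q)⁻¹ = α by field_simp] at h3
  refine h3.congr' ?_
  filter_upwards [h1, hk] with p hp1 hpk
  rw [hillEstimator, hillMean_eq hpk hp1]
  rfl

lemma tendsto_ksDist_zero {U : Ultrafilter Sample} {T : ℝ → ℝ} (hT : Continuous T)
    (hanti : Antitone T) (hT0 : Tendsto T atTop (𝓝 0))
    (h : ∀ b, Tendsto (fun p : Sample => empTail p.2 b) U (𝓝 (T b)))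
    (h1 : ∀ᶠ p : Sample in U, ∀ i, 1 ≤ p.2 i) {k : Sample → ℕ}
    (hk : ∀ᶠ p : Sample in U, k p < p.1) {x₀ q₀ c α : ℝ} (hx₀ : 0 < x₀) (hq₀ : x₀ < q₀)
    (hc : 0 < c) (hα : 0 < α) (hpar : ∀ y, x₀ ≤ y → T y = c * y ^ (-α))
    (hkt : Tendsto (fun p : Sample => (k p : ℝ) / p.1) U (𝓝 (T q₀)))
    (hlog : Tendsto (fun p : Sample => empLogExcess p.2 q₀) U (𝓝 (T q₀ / α))) :
    Tendsto (fun p : Sample => ksDist p.2 (k p)) U (𝓝 0) := by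
  have hq₀0 : 0 < q₀ := hx₀.trans hq₀
  have hTq : 0 < T q₀ := by
    rw [hpar _ hq₀.le]; exact mul_pos hc (Real.rpow_pos_of_pos hq₀0 _)
  obtain ⟨q, hq1, hlim, hTqe⟩ := exists_tendsto_orderStat hT hT0 h h1 hk hTq hkt
  -- `T` is strictly decreasing on `[x₀, ∞)`, and below x₀ it is at least `T x₀ > T q₀`.
  obtain rfl : q = q₀ := by
    have hxq : x₀ ≤ q := by
      by_contra! hlt
      have h2 : T x₀ ≤ T q := hanti hlt.le
      rw [hTqe, hpar _ le_rfl, hpar _ hq₀.le] at h2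
      exact (mul_lt_mul_of_pos_left
        (Real.rpow_lt_rpow_of_neg hx₀ hq₀ (neg_neg_of_pos hα)) hc).not_ge h2
    rw [hpar _ hxq, hpar _ hq₀.le] at hTqe
    exact (Real.rpow_left_inj (hx₀.le.trans hxq) hq₀0.le (neg_ne_zero.2 hα.ne')).1
      (mul_left_cancel₀ hc.ne' hTqe)
  have hhill := tendsto_hillEstimator h1 hk hq₀0 hα hTq hkt hlim hlog
  refine tendsto_order.2 ⟨fun a ha => Eventually.of_forall fun p =>
    ha.trans_le (ksDist_nonneg _), fun δ hδ => ?_⟩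
  by_contra hcon
  rw [← Ultrafilter.eventually_not] at hcon
  have hex : ∀ᶠ p : Sample in U, ∃ y : ℝ, 1 ≤ y ∧ δ / 2 <
      |empTail p.2 (y * orderStat p.2 (p.1 - k p)) / ((k p : ℝ) / p.1) -
        y ^ (-hillEstimator p.2 (k p))| := by
    filter_upwards [hcon, h1, hk] with p hp hp1 hpk
    exact exists_lt_of_lt_ksDist hpk hp1 (by linarith)
  -- A nearly worst y is chosen for each sample. Along the ultrafilter it either converges or tends
  -- to infinity, and the discrepancy vanishes in both cases.
  obtain ⟨y, hy⟩ := hex.choice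
  have hy1 : ∀ᶠ p in (U : Filter Sample), 1 ≤ y p := hy.mono fun p hp => hp.1
  suffices hlim0 : Tendsto (fun p : Sample =>
      empTail p.2 (y p * orderStat p.2 (p.1 - k p)) / ((k p : ℝ) / p.1) -
        y p ^ (-hillEstimator p.2 (k p))) U (𝓝 0) by
    have h2 := hlim0.abs
    rw [abs_zero] at h2
    obtain ⟨p, hp, hp'⟩ := (hy.and (h2.eventually_lt_const (half_pos hδ))).exists
    exact hp.2.not_gt hp'
  by_cases hbdd : ∃ B, ∀ᶠ p in (U : Filter Sample), y p ≤ B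
  · obtain ⟨B, hB⟩ := hbdd
    obtain ⟨y₀, hy₀, hylim⟩ := exists_tendsto_of_eventually_mem_Icc (hy1.and hB)
    have hy₀0 : 0 < y₀ := zero_lt_one.trans_le hy₀.1
    have h2 := ((tendsto_empTail_comp hT h (hylim.mul hlim)).div hkt hTq.ne').sub
      (hylim.rpow hhill.neg (Or.inl hy₀0.ne'))
    have h3 : T (y₀ * q) / T q - y₀ ^ (-α) = 0 := by
      rw [hpar (y₀ * q) (by nlinarith [hy₀.1]), hpar q hq₀.le,
        Real.mul_rpow hy₀0.le hq₀0.le]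
      have := (Real.rpow_pos_of_pos hq₀0 (-α)).ne'
      field_simp
      ring
    rwa [h3] at h2
  · push Not at hbdd
    have hytop : Tendsto y U atTop := by
      refine tendsto_atTop.2 fun B => ?_
      filter_upwards [hbdd B] with p hp using hp.le
    have h2 : Tendsto (fun p : Sample => y p * orderStat p.2 (p.1 - k p)) U atTop :=
      hytop.atTop_mul_pos hq₀0 hlim
    have h3 : Tendsto (fun p : Sample => y p ^ (-hillEstimator p.2 (k p))) U (𝓝 0) := by
      have h4 := (tendsto_rpow_neg_atTop (half_pos hα)).comp hytop
      refine squeeze_zero' ?_ ?_ h4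
      · filter_upwards [hy1] with p hp using Real.rpow_nonneg (zero_le_one.trans hp) _
      · filter_upwards [hy1, hhill.eventually_const_lt (half_lt_self hα)] with p hp hp2
        exact Real.rpow_le_rpow_of_exponent_le hp (neg_le_neg hp2.le)
    have h5 := ((tendsto_empTail_comp_atTop hT0 h h2).div hkt hTq.ne').sub h3
    simpa using h5

lemma exists_pareto_of_tendsto_ksDist_zero {U : Ultrafilter Sample} {T : ℝ → ℝ}
    (hT : Continuous T) (hpos : ∀ z, 0 < T z) (hT0 : Tendsto T atTop (𝓝 0))
    (h : ∀ b, Tendsto (fun p : Sample => empTail p.2 b) U (𝓝 (T b)))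
    (h1 : ∀ᶠ p : Sample in U, ∀ i, 1 ≤ p.2 i) {k : Sample → ℕ}
    (hk : ∀ᶠ p : Sample in U, k p < p.1) {t : ℝ} (ht : 0 < t)
    (hkt : Tendsto (fun p : Sample => (k p : ℝ) / p.1) U (𝓝 t))
    (hD : Tendsto (fun p : Sample => ksDist p.2 (k p)) U (𝓝 0)) :
    ∃ q a : ℝ, 1 ≤ q ∧ T q = t ∧ ∀ y, 1 ≤ y → T (y * q) = t * y ^ a := by
  obtain ⟨q, hq1, hlim, hTq⟩ := exists_tendsto_orderStat hT hT0 h h1 hk ht hkt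
  have hpow : ∀ y : ℝ, 1 ≤ y → Tendsto (fun p : Sample => y ^ (-hillEstimator p.2 (k p))) U
      (𝓝 (T (y * q) / t)) := by
    intro y hy
    have h2 := (tendsto_empTail_comp hT h (hlim.const_mul y)).div hkt ht.ne'
    have h3 : Tendsto (fun p : Sample =>
        empTail p.2 (y * orderStat p.2 (p.1 - k p)) / ((k p : ℝ) / p.1) -
          y ^ (-hillEstimator p.2 (k p))) U (𝓝 0) := by
      refine squeeze_zero_norm' ?_ hD
      filter_upwards [h1, hk] with p hp1 hpk using le_ksDist hpk hp1 hy
    simpa using h2.sub h3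
  -- At y = e the logarithm of the power is the exponent itself, so Hill's estimator converges.
  have hexp : Tendsto (fun p : Sample => -hillEstimator p.2 (k p)) U
      (𝓝 (Real.log (T (Real.exp 1 * q) / t))) := by
    have h2 := (Real.continuousAt_log (div_pos (hpos _) ht).ne').tendsto.comp
      (hpow (Real.exp 1) (Real.one_le_exp zero_le_one))
    refine h2.congr fun p => ?_
    simp
  refine ⟨q, Real.log (T (Real.exp 1 * q) / t), hq1, hTq, fun y hy => ?_⟩
  have hy0 : 0 < y := zero_lt_one.trans_le hy
  have h2 := tendsto_nhds_unique (hpow y hy)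
    (tendsto_const_nhds.rpow hexp (Or.inl hy0.ne'))
  rw [← h2]
  field_simp

lemma exponent_eq {T : ℝ → ℝ} {x₀ c α q t a : ℝ} (hq : 0 < q) (hc : 0 < c)
    (hpar : ∀ y, x₀ ≤ y → T y = c * y ^ (-α)) (h : ∀ y, 1 ≤ y → T (y * q) = t * y ^ a) :
    a = -α := by
  -- This puts `y * q` beyond x₀; comparing the two power laws at y and at e·y isolates the
  -- exponent.
  set y := max 1 (x₀ / q) with hy
  have hy1 : 1 ≤ y := le_max_left _ _
  have hy0 : 0 < y := zero_lt_one.trans_le hy1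
  have hyx : x₀ ≤ y * q := (div_le_iff₀ hq).1 (le_max_right _ _)
  have he : 1 ≤ Real.exp 1 := Real.one_le_exp zero_le_one
  have e1 := h y hy1
  have e2 := h (Real.exp 1 * y) (one_le_mul_of_one_le_of_one_le he hy1)
  rw [hpar _ hyx] at e1
  rw [mul_assoc, hpar _ (hyx.trans (le_mul_of_one_le_left (by positivity) he)),
    Real.mul_rpow (Real.exp_pos _).le (by positivity),
    Real.mul_rpow (Real.exp_pos _).le hy0.le, mul_left_comm, mul_left_comm t, ← e1] at e2
  have h3 := mul_right_cancel₀ (mul_pos hc (Real.rpow_pos_of_pos (mul_pos hy0 hq) _)).ne' e2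
  rw [← Real.exp_mul, ← Real.exp_mul, Real.exp_eq_exp] at h3
  linarith


/-! ### Convergence in probability as a filter, and the law of large numbers. -/

/-- The filter of sets of samples that contain `(X_0, …, X_{n-1})` with probability tending to `1`
as `n → ∞`. -/
def sampleFilter {Ω : Type*} [MeasurableSpace Ω] (P : Measure Ω) (X : ℕ → Ω → ℝ) :
    Filter Sample where
  sets := {S | Tendsto (fun n : ℕ => P {ω | (⟨n, fun i => X i ω⟩ : Sample) ∉ S}) atTop (𝓝 0)}
  univ_sets := by simp
  sets_of_superset {S S'} hS hSS' := tendsto_of_tendsto_of_tendsto_of_le_of_le tendsto_const_nhds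
    hS (fun _ => zero_le) fun _ => measure_mono fun _ hω h => hω (hSS' h)
  inter_sets {S S'} hS hS' := by
    have h := Tendsto.add hS hS'
    rw [add_zero] at h
    refine tendsto_of_tendsto_of_tendsto_of_le_of_le tendsto_const_nhds h (fun _ => zero_le)
      fun n => (measure_mono fun ω hω => ?_).trans (measure_union_le _ _)
    exact not_and_or.1 hω

section

variable {Ω : Type*} [MeasurableSpace Ω] {P : Measure Ω} {X : ℕ → Ω → ℝ}

lemma eventually_sampleFilter {p : Sample → Prop} : (∀ᶠ s in sampleFilter P X, p s) ↔
    Tendsto (fun n : ℕ => P {ω | ¬ p ⟨n, fun i => X i ω⟩}) atTop (𝓝 0) := Iff.rfl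

lemma tendsto_fst_sampleFilter : Tendsto Sigma.fst (sampleFilter P X) atTop := by
  refine tendsto_atTop.2 fun N => eventually_sampleFilter.2 ?_
  refine tendsto_const_nhds.congr' ?_
  filter_upwards [eventually_ge_atTop N] with n hn
  simp [hn]

lemma eventually_sampleFilter_of_ae {p : ℝ → Prop} (h : ∀ i, ∀ᵐ ω ∂P, p (X i ω)) :
    ∀ᶠ s in sampleFilter P X, ∀ i, p (s.2 i) := by
  refine eventually_sampleFilter.2 (tendsto_const_nhds.congr fun n => ?_)
  exact (ae_iff.1 (ae_all_iff.2 fun i : Fin n => h i)).symm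

lemma tendsto_sampleFilter_of_tendstoInMeasure {f : Sample → ℝ} {a : ℝ}
    (h : TendstoInMeasure P (fun (n : ℕ) ω => f ⟨n, fun i => X i ω⟩) atTop fun _ => a) :
    Tendsto f (sampleFilter P X) (𝓝 a) := by
  refine Metric.tendsto_nhds.2 fun ε hε => eventually_sampleFilter.2 ?_
  simpa only [not_lt] using tendstoInMeasure_iff_dist.1 h ε hε

lemma tendsto_mean_sampleFilter [IsProbabilityMeasure P] {μ : Measure ℝ}
    (hlaw : ∀ i, HasLaw (X i) μ P) (hindep : iIndepFun X P) {g : ℝ → ℝ} (hg : Measurable g)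
    (hint : Integrable g μ) :
    Tendsto (fun p : Sample => (∑ i, g (p.2 i)) / p.1) (sampleFilter P X) (𝓝 (∫ z, g z ∂μ)) := by
  have hae : ∀ i, AEMeasurable (fun ω => g (X i ω)) P := fun i =>
    hg.comp_aemeasurable (hlaw i).aemeasurable
  have hint0 : Integrable (fun ω => g (X 0 ω)) P := by
    rw [← (hlaw 0).map_eq] at hint
    exact hint.comp_aemeasurable (hlaw 0).aemeasurable
  have h := strong_law_ae_real (μ := P) (fun i ω => g (X i ω)) hint0
    (fun i j hij => (hindep.comp (fun _ => g) fun _ => hg).indepFun hij)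
    (fun i => ((hlaw i).identDistrib (hlaw 0)).comp hg)
  have hmean : ∫ ω, g (X 0 ω) ∂P = ∫ z, g z ∂μ := (hlaw 0).integral_comp hint.aestronglyMeasurable
  rw [hmean] at h
  refine tendsto_sampleFilter_of_tendstoInMeasure (tendstoInMeasure_of_tendsto_ae (fun n => ?_) ?_)
  · exact ((Finset.aemeasurable_fun_sum Finset.univ fun (i : Fin n) _ => hae i).div_const
      (n : ℝ)).aestronglyMeasurable
  · filter_upwards [h] with ω hω
    simpa only [Finset.sum_range] using hω

end

/-! ### Consequences of the assumptions on the law. -/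

lemma tail_cdf_eq {μ : Measure ℝ} [IsProbabilityMeasure μ] (b : ℝ) :
    tail (cdf μ) b = μ.real (Ioi b) := by
  rw [tail, cdf_eq_real, ← compl_Iic, probReal_compl_eq_one_sub measurableSet_Iic]

lemma tail_cdf_antitone {μ : Measure ℝ} : Antitone (tail (cdf μ)) :=
  fun _ _ h => sub_le_sub_left (monotone_cdf μ h) 1

lemma tendsto_tail_cdf_atTop {μ : Measure ℝ} : Tendsto (tail (cdf μ)) atTop (𝓝 0) := by
  have h := (tendsto_cdf_atTop μ).const_sub 1
  rwa [sub_self] at h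

lemma ae_one_le {μ : Measure ℝ} [IsProbabilityMeasure μ]
    (hsupp : ∀ x : ℝ, x < 1 → cdf μ x = 0) (hcont : Continuous (cdf μ)) :
    ∀ᵐ z ∂μ, 1 ≤ z := by
  have h1 : cdf μ 1 = 0 := by
    refine tendsto_nhds_unique
      ((hcont.tendsto 1).mono_left (nhdsWithin_le_nhds (s := Iio 1))) (tendsto_const_nhds.congr' ?_)
    filter_upwards [self_mem_nhdsWithin] with x hx using (hsupp x hx).symm
  have h2 : μ (Iic 1) = 0 := by rw [← ofReal_cdf, h1, ENNReal.ofReal_zero]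
  exact ae_iff.2 (measure_mono_null (fun z hz => (not_le.1 hz).le) h2)

/-- Beyond a Pareto point, log(z/q) has an exponential tail with rate α and mass `T q`; the
layer-cake formula integrates it. -/
lemma integrable_log_and_integral {μ : Measure ℝ} [IsProbabilityMeasure μ]
    (hpos : ∀ᵐ z ∂μ, 1 ≤ z) {x₀ c α q : ℝ} (hx₀ : 0 < x₀)
    (hq : x₀ ≤ q) (hα : 0 < α) (hpar : ∀ y, x₀ ≤ y → tail (cdf μ) y = c * y ^ (-α)) :
    Integrable (fun z => max 0 (Real.log (z / q))) μ ∧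
      ∫ z, max 0 (Real.log (z / q)) ∂μ = tail (cdf μ) q / α := by
  have hq0 : 0 < q := hx₀.trans_le hq
  have hmeas : Measurable fun z : ℝ => max 0 (Real.log (z / q)) := by fun_prop
  have hnn : 0 ≤ᵐ[μ] fun z : ℝ => max 0 (Real.log (z / q)) :=
    Eventually.of_forall fun _ => le_max_left _ _
  have hTq : 0 ≤ tail (cdf μ) q := by rw [tail_cdf_eq]; exact measureReal_nonneg
  have hmeasure : ∀ t ∈ Ioi (0 : ℝ), μ {z | t < max 0 (Real.log (z / q))} =
      ENNReal.ofReal (tail (cdf μ) q * Real.exp (-α * t)) := by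
    intro t ht
    have h1 : μ {z | t < max 0 (Real.log (z / q))} = μ (Ioi (Real.exp t * q)) := by
      refine measure_congr ?_
      filter_upwards [hpos] with z hz
      have hz0 : 0 < z := zero_lt_one.trans_le hz
      refine propext ?_
      change t < max 0 (Real.log (z / q)) ↔ Real.exp t * q < z
      rw [lt_max_iff, or_iff_right (not_lt.2 (le_of_lt ht)), Real.lt_log_iff_exp_lt (div_pos hz0 hq0),
        lt_div_iff₀ hq0]
    have h2 : x₀ ≤ Real.exp t * q :=
      hq.trans (le_mul_of_one_le_left hq0.le (Real.one_le_exp (le_of_lt ht)))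
    rw [h1, ← ofReal_measureReal, ← tail_cdf_eq, hpar _ h2, hpar _ hq,
      Real.mul_rpow (Real.exp_pos t).le hq0.le, ← Real.exp_mul]
    congr 1
    rw [mul_comm t]; ring
  have hα' : -α < 0 := neg_neg_of_pos hα
  have hlint : ∫⁻ z, ENNReal.ofReal (max 0 (Real.log (z / q))) ∂μ =
      ENNReal.ofReal (tail (cdf μ) q / α) := by
    rw [lintegral_eq_lintegral_meas_lt μ hnn hmeas.aemeasurable,
      setLIntegral_congr_fun measurableSet_Ioi hmeasure,
      ← ofReal_integral_eq_lintegral_ofReal ((integrableOn_exp_mul_Ioi hα' 0).const_mul _)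
        (Eventually.of_forall fun t => mul_nonneg hTq (Real.exp_pos _).le),
      integral_const_mul, integral_exp_mul_Ioi hα' 0]
    simp [div_eq_mul_inv]
  refine ⟨⟨hmeas.aestronglyMeasurable, ?_⟩, ?_⟩
  · rw [hasFiniteIntegral_iff_ofReal hnn, hlint]
    exact ENNReal.ofReal_lt_top
  · rw [integral_eq_lintegral_of_nonneg_ae hnn hmeas.aestronglyMeasurable, hlint,
      ENNReal.toReal_ofReal (by positivity)]

/-- If F were constant on [a, b] at a level u in (0, 1), the quantile would be at most a at u but at
least b just above u, contradicting continuity. -/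
lemma tail_cdf_lt_of_lt {μ : Measure ℝ} (hsupp : ∀ x : ℝ, x < 1 → cdf μ x = 0)
    (hquant : ContinuousOn (quantile (cdf μ)) (Ioo 0 1)) {a b : ℝ} (hab : a < b)
    (ha : tail (cdf μ) a < 1) (hb : 0 < tail (cdf μ) b) :
    tail (cdf μ) b < tail (cdf μ) a := by
  by_contra! hle
  have hF : cdf μ b ≤ cdf μ a := by unfold tail at hle; linarith
  have ha0 : 0 < cdf μ a := by unfold tail at ha; linarith
  have hb1 : cdf μ b < 1 := by unfold tail at hb; linarith
  have hu : cdf μ a ∈ Ioo (0 : ℝ) 1 := ⟨ha0, (monotone_cdf μ hab.le).trans_lt hb1⟩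
  have hapos : 0 < a := by
    by_contra! h
    exact ha0.ne' (hsupp a (h.trans_lt zero_lt_one))
  have h1 : quantile (cdf μ) (cdf μ a) ≤ a := csInf_le ⟨0, fun _ hx => hx.1.le⟩ ⟨hapos, le_rfl⟩
  have h2 : Tendsto (quantile (cdf μ)) (𝓝[>] (cdf μ a)) (𝓝 (quantile (cdf μ) (cdf μ a))) :=
    (hquant.continuousAt (Ioo_mem_nhds hu.1 hu.2)).tendsto.mono_left nhdsWithin_le_nhds
  have h3 : b ≤ quantile (cdf μ) (cdf μ a) := by
    refine ge_of_tendsto h2 ?_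
    filter_upwards [Ioo_mem_nhdsGT hu.2] with v hv
    refine le_csInf ?_ fun y hy => ?_
    · obtain ⟨y, hy, hy0⟩ := (((tendsto_cdf_atTop μ).eventually_const_lt hv.2).and
        (eventually_gt_atTop 0)).exists
      exact ⟨y, hy0, hy.le⟩
    · by_contra! hlt
      exact ((monotone_cdf μ hlt.le).trans hF).not_gt (hv.1.trans_le hy.2)
  exact (h3.trans h1).not_gt hab

end PLFit

/-! ### The contradiction along an ultrafilter. -/

theorem mainTheorem6 {Ω : Type*} [MeasurableSpace Ω] (P : Measure Ω) [IsProbabilityMeasure P]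
    (μ : Measure ℝ) [IsProbabilityMeasure μ] (X : ℕ → Ω → ℝ)
    (hlaw : ∀ i, HasLaw (X i) μ P) (hindep : iIndepFun X P)
    (hsupp : ∀ x : ℝ, x < 1 → cdf μ x = 0)
    (hcont : Continuous (cdf μ))
    (hquant : ContinuousOn (PLFit.quantile (cdf μ)) (Set.Ioo 0 1))
    (α x₀ : ℝ) (hα : 0 < α)
    (hx₀ : IsLeast {x : ℝ | PLFit.ParetoFrom (cdf μ) α x} x₀) :
    ∀ ε : ℝ, 0 < ε →
      Tendsto
        (fun n : ℕ => P {ω | (n : ℝ) * PLFit.tail (cdf μ) (x₀ - ε) ≤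
          (PLFit.kappaStar (fun i : Fin n => X i ω) : ℝ)})
        atTop (𝓝 0) := by
  intro ε hε
  obtain ⟨⟨hx₀pos, c, hc, hpar⟩, hmin⟩ := hx₀
  set T := PLFit.tail (cdf μ) with hTdef
  have hT : Continuous T := continuous_const.sub hcont
  have hanti : Antitone T := PLFit.tail_cdf_antitone
  have hT0 : Tendsto T atTop (𝓝 0) := PLFit.tendsto_tail_cdf_atTop
  have hTpos : ∀ z, 0 < T z := fun z => by
    refine lt_of_lt_of_le ?_ (hanti (le_max_left z x₀))
    rw [hpar _ (le_max_right _ _)]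
    exact mul_pos hc (Real.rpow_pos_of_pos (hx₀pos.trans_le (le_max_right _ _)) _)
  have hge := PLFit.ae_one_le hsupp hcont
  -- Any fixed point strictly beyond x₀ would serve as reference threshold.
  have hq₀ : x₀ < 2 * x₀ := by linarith
  obtain ⟨hlogint, hlogval⟩ := PLFit.integrable_log_and_integral hge hx₀pos hq₀.le hα hpar
  suffices h : ∀ᶠ p : PLFit.Sample in PLFit.sampleFilter P X,
      (PLFit.kappaStar p.2 : ℝ) < p.1 * T (x₀ - ε) by
    simpa only [not_lt] using PLFit.eventually_sampleFilter.1 h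
  by_contra hcon
  have hne : (PLFit.sampleFilter P X ⊓
      𝓟 {p | ¬ (PLFit.kappaStar p.2 : ℝ) < p.1 * T (x₀ - ε)}).NeBot :=
    frequently_iff_neBot.1 (not_eventually.1 hcon)
  obtain ⟨U, hU⟩ := Ultrafilter.exists_le (PLFit.sampleFilter P X ⊓
      𝓟 {p | ¬ (PLFit.kappaStar p.2 : ℝ) < p.1 * T (x₀ - ε)})
  have hUG : (U : Filter PLFit.Sample) ≤ PLFit.sampleFilter P X := hU.trans inf_le_left
  have hbad : ∀ᶠ p : PLFit.Sample in U, p.1 * T (x₀ - ε) ≤ (PLFit.kappaStar p.2 : ℝ) := by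
    filter_upwards [le_principal_iff.1 (hU.trans inf_le_right)] with p hp using not_lt.1 hp
  have hn : Tendsto (fun p : PLFit.Sample => p.1) U atTop :=
    PLFit.tendsto_fst_sampleFilter.mono_left hUG
  have hn2 : ∀ᶠ p : PLFit.Sample in U, 2 ≤ p.1 := hn.eventually_ge_atTop 2
  have h1 : ∀ᶠ p : PLFit.Sample in U, ∀ i, 1 ≤ p.2 i :=
    hUG (PLFit.eventually_sampleFilter_of_ae fun i =>
      ((hlaw i).ae_iff (measurableSet_Ici.mem)).2 hge)
  have hemp : ∀ b, Tendsto (fun p : PLFit.Sample => PLFit.empTail p.2 b) U (𝓝 (T b)) := by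
    intro b
    have h := (PLFit.tendsto_mean_sampleFilter hlaw hindep
      (measurable_const.indicator (measurableSet_Ioi (a := b)))
      ((integrable_const (1 : ℝ)).indicator measurableSet_Ioi)).mono_left hUG
    rwa [integral_indicator_const _ measurableSet_Ioi, smul_eq_mul, mul_one,
      ← PLFit.tail_cdf_eq] at h
  have hlog : Tendsto (fun p : PLFit.Sample => PLFit.empLogExcess p.2 (2 * x₀)) U
      (𝓝 (T (2 * x₀) / α)) := by
    rw [← hlogval]
    exact (PLFit.tendsto_mean_sampleFilter hlaw hindep (by fun_prop) hlogint).mono_left hUG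
  have hκ : ∀ᶠ p : PLFit.Sample in U, PLFit.kappaStar p.2 < p.1 := by
    filter_upwards [hn2] with p hp
    have := Finset.mem_Icc.1 (PLFit.kappaStar_spec hp p.2).1
    omega
  -- Otherwise the bad event would force κ ≥ n, whereas κ ≤ n - 1.
  have hs1 : T (x₀ - ε) < 1 := by
    obtain ⟨p, hp, hpκ⟩ := (hbad.and hκ).exists
    by_contra! hge1
    have h2 : (p.1 : ℝ) ≤ PLFit.kappaStar p.2 :=
      (le_mul_of_one_le_right (Nat.cast_nonneg _) hge1).trans hp
    exact (Nat.cast_le.1 h2).not_gt hpκ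
  have hs : T x₀ < T (x₀ - ε) :=
    PLFit.tail_cdf_lt_of_lt hsupp hquant (by linarith) hs1 (hTpos _)
  have hTq1 : T (2 * x₀) < 1 := (hanti hq₀.le).trans_lt (hs.trans hs1)
  -- the reference index, for which the distance tends to zero
  have hjt : Tendsto (fun p : PLFit.Sample => (⌊T (2 * x₀) * p.1⌋₊ : ℝ) / p.1) U
      (𝓝 (T (2 * x₀))) :=
    (tendsto_nat_floor_mul_div_atTop (hTpos _).le).comp (tendsto_natCast_atTop_atTop.comp hn)
  have hj : ∀ᶠ p : PLFit.Sample in U,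
      1 ≤ ⌊T (2 * x₀) * p.1⌋₊ ∧ ⌊T (2 * x₀) * p.1⌋₊ < p.1 := by
    filter_upwards [hjt.eventually_const_lt (hTpos _), hjt.eventually_lt_const hTq1, hn2]
      with p hp0 hp1 hp2
    constructor
    · by_contra! h
      rw [Nat.lt_one_iff.1 h] at hp0
      simp at hp0
    · rw [div_lt_one (by norm_cast; omega)] at hp1
      exact_mod_cast hp1
  have hDj := PLFit.tendsto_ksDist_zero hT hanti hT0 hemp h1 (hj.mono fun _ h => h.2) hx₀pos hq₀
    hc hα hpar hjt hlog
  have hDκ : Tendsto (fun p : PLFit.Sample => PLFit.ksDist p.2 (PLFit.kappaStar p.2)) U (𝓝 0) := by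
    refine squeeze_zero' (Eventually.of_forall fun _ => PLFit.ksDist_nonneg _) ?_ hDj
    filter_upwards [hn2, hj] with p hp hpj
    exact (PLFit.kappaStar_spec hp p.2).2 _ (Finset.mem_Icc.2 ⟨hpj.1, by omega⟩)
  have hmem : ∀ᶠ p : PLFit.Sample in U,
      (PLFit.kappaStar p.2 : ℝ) / p.1 ∈ Icc (T (x₀ - ε)) 1 := by
    filter_upwards [hn2, hκ, hbad] with p hp hpκ hpb
    have hp0 : (0 : ℝ) < p.1 := by norm_cast; omega
    refine ⟨(le_div_iff₀ hp0).2 (by linarith), (div_le_one hp0).2 (by exact_mod_cast hpκ.le)⟩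
  obtain ⟨t, ht, htlim⟩ := PLFit.exists_tendsto_of_eventually_mem_Icc hmem
  have ht0 : 0 < t := (hTpos _).trans_le ht.1
  obtain ⟨q, a, hq1, hTq, hpq⟩ :=
    PLFit.exists_pareto_of_tendsto_ksDist_zero hT hTpos hT0 hemp h1 hκ ht0 htlim hDκ
  have hq0 : 0 < q := zero_lt_one.trans_le hq1
  obtain rfl := PLFit.exponent_eq hq0 hc hpar hpq
  have hqp : PLFit.ParetoFrom (cdf μ) α q := by
    refine ⟨hq0, t * q ^ α, mul_pos ht0 (Real.rpow_pos_of_pos hq0 _), fun z hz => ?_⟩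
    have h2 := hpq (z / q) ((one_le_div hq0).2 hz)
    rw [div_mul_cancel₀ _ hq0.ne', Real.div_rpow (hq0.le.trans hz) hq0.le,
      Real.rpow_neg hq0.le, div_inv_eq_mul] at h2
    rw [← hTdef, h2]
    ring
  -- Minimality gives x₀ ≤ q, against t ≥ `T (x₀ - ε)` > `T x₀`.
  have h3 : t ≤ T x₀ := hTq ▸ hanti (hmin hqp)
  exact (hs.trans_le ht.1).not_ge h3
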